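/- **Definitions.** A symmetric $(v,k,\lambda)$ design over a set $V$ of $v$ points is a family of $v$ blocks, each a $k$-subset of $V$, such that every pair of distinct points lies in exactly $\lambda$ blocks. Its incidence matrix is $([p_i\in B_j])_{i,j}$, for any ordering of points and blocks. $\mathcal C^n(v,k,\lambda)$ is the set of functions $C:\{1,\dots,v\}^n\to\{0,1\}$ all of whose $2$-dimensional slices (two coordinates vary, the others are fixed) are incidence matrices of symmetric $(v,k,\lambda)$ designs. Two such cubes are equivalent if one is obtained from the other by permuting the values of each coordinate (independently) and permuting the order of the $n$ coordinates. A $(v,k,\lambda)$ difference set in a group $G$ of order $v$ is a $k$-subset $D\subseteq G$ such that every $g\ne 1$ has exactly $\lambda$ representations $g=d_1^{-1}d_2$ with $d_1,d_2\in D$; its development is the set of blocks $\{gD\mid g\in G\}$. For a group $G=\{g_1,\dots,g_v\}$ (any ordering), a difference cube is a cube $C(i_1,\dots,i_n)=[g_{i_1}\cdots g_{i_n}\in D]$ with $D$ a difference set in $G$; a group cube in $\mathcal C^n(v,k,\lambda)$ is a cube $C(i_1,\dots,i_n)=[g_{i_2}\cdots g_{i_n}\in B_{i_1}]$, where $\{B_1,\dots,B_v\}$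 is a $(v,k,\lambda)$ design over $G$ all of whose blocks are $(v,k,\lambda)$ difference sets in $G$. A cube is a non-difference cube if it is not equivalent to any difference cube (of any group of order $v$). **Two series of designs.** Number the elements of $\mathbb Z_2^4$ lexicographically as $g_0=0000,\ g_1=0001,\dots,g_{15}=1111$, and let $B_i=g_i+\{g_1,g_2,g_3,g_4,g_8,g_{12}\}$. Let $B'_i=B_i\,\Delta\,\{g_2,g_3,g_{14},g_{15}\}$ for $i\in\{0,1,12,13\}$ and $B'_i=B_i$ otherwise. Let $B''_i=B'_i\,\Delta\,\{g_6,g_7,g_{14},g_{15}\}$ for $i\in\{0,1,4,5\}$ and $B''_i=B'_i$ otherwise. Put $\mathcal D_2(2)=\{B'_0,\dots,B'_{15}\}$ and $\mathcal D_3(2)=\{B''_0,\dots,B''_{15}\}$. For $r\in\{2,3\}$ and $m\ge 2$, let $\mathcal D_r(m+1)$ be the family of blocks in $\mathbb Z_2^{2(m+1)}=\mathbb Z_2^{2m}\times\mathbb Z_2^2$ whose incidence matrix is the $4\times4$ block matrix with $J-A$ on the diagonal and $A$ elsewhere, where $A$ is the incidence matrix of $\mathcal D_r(m)$, $J$ is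 the all-ones matrix, and block rows and block columns are indexed by $\mathbb Z_2^2$. That is, if the blocks of $\mathcal D_r(m)$ are $B_y$ $(y\in\mathbb Z_2^{2m})$, then those of $\mathcal D_r(m+1)$ are $$B_{(y,t)}=\{(x,s)\mid s=t,\ x\notin B_y\}\cup\{(x,s)\mid s\ne t,\ x\in B_y\}.$$ **Theorem.** Let $m\ge2$, $n\ge3$, and $v=4^m$, $k=2^{m-1}(2^m-1)$, $\lambda=2^{m-1}(2^{m-1}-1)$. Each of $\mathcal D_2(m)$ and $\mathcal D_3(m)$ is a symmetric $(v,k,\lambda)$ design over $\mathbb Z_2^{2m}$ all of whose blocks are $(v,k,\lambda)$ difference sets in $\mathbb Z_2^{2m}$, but neither is the development of a difference set in $\mathbb Z_2^{2m}$. The set $\mathcal C^n(v,k,\lambda)$ contains at least two inequivalent group cubes that are non-difference cubes; namely, for a suitable ordering $g_1,\dots,g_v$ of $\mathbb Z_2^{2m}$, the two cubes $$C(i_1,\dots,i_n)=[\,g_{i_2}+\cdots+g_{i_n}\in B_{g_{i_1}}\,],$$ where $B_y$ $(y\in\mathbb Z_2^{2m})$ are the blocks of $\mathcal D_2(m)$,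 respectively of $\mathcal D_3(m)$, have these properties. -/

import Mathlib

namespace DesignCube

/-- The blocks `B j` (indexed by `ι`) form a symmetric `(v, k, lam)` design over the point set `P`:
there are `v` points and `v` blocks, every block has `k` points, and every pair of distinct points
lies in exactly `lam` blocks. -/
structure IsSymmetricDesign {P ι : Type} (B : ι → Finset P) (v k lam : ℕ) : Prop where
  card_points : Nat.card P = v
  card_blocks : Nat.card ι = v
  block_card : ∀ j, (B j).card = k
  pair_count : ∀ p q : P, p ≠ q → {j : ι | p ∈ B j ∧ q ∈ B j}.ncard = lam

/-- `A` is an incidence matrix of a symmetric `(v, k, lam)` design: rows are points, and the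
columns are the blocks. -/
def IsIncidenceMatrix {v : ℕ} (A : Fin v → Fin v → Bool) (k lam : ℕ) : Prop :=
  IsSymmetricDesign (fun j : Fin v => Finset.univ.filter fun i : Fin v => A i j = true) v k lam

/-- `n`-dimensional incidence cubes of order `v`, with `{0, 1}`-entries. -/
abbrev Cube (n v : ℕ) : Type := (Fin n → Fin v) → Bool

/-- The slice of `C` with varying coordinates `x` (row index) and `y` (column index), the other
coordinates being fixed to the values of `f`. -/
def slice {n v : ℕ} (C : Cube n v) (x y : Fin n) (f : Fin n → Fin v) : Fin v → Fin v → Bool :=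
  fun a b => C (Function.update (Function.update f x a) y b)

/-- The set `C^n(v, k, lam)` of `n`-dimensional cubes of symmetric `(v, k, lam)` designs. -/
def designCubes (n v k lam : ℕ) : Set (Cube n v) :=
  {C | ∀ x y : Fin n, x ≠ y → ∀ f : Fin n → Fin v, IsIncidenceMatrix (slice C x y f) k lam}

/-- The isotopy action: `C^α (i₁, …, iₙ) = C (α₁⁻¹ i₁, …, αₙ⁻¹ iₙ)`. -/
def isotope {n v : ℕ} (α : Fin n → Equiv.Perm (Fin v)) (C : Cube n v) : Cube n v :=
  fun i => C fun j => (α j)⁻¹ (i j)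

/-- Conjugation: `C^γ (i₁, …, iₙ) = C (i_{γ⁻¹ 1}, …, i_{γ⁻¹ n})`. -/
def conjugate {n v : ℕ} (γ : Equiv.Perm (Fin n)) (C : Cube n v) : Cube n v :=
  fun i => C fun j => i (γ⁻¹ j)

/-- Two cubes are equivalent if a paratopy (an isotopy followed by a conjugation, which is the
general element of the wreath product) maps one onto the other. -/
def Equivalent {n v : ℕ} (C C' : Cube n v) : Prop :=
  ∃ (α : Fin n → Equiv.Perm (Fin v)) (γ : Equiv.Perm (Fin n)), C' = conjugate γ (isotope α C)

/-- `D` is a `(v, k, lam)` difference set in the group `G`. -/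
structure IsDifferenceSet {G : Type} [Group G] (D : Finset G) (v k lam : ℕ) : Prop where
  card_group : Nat.card G = v
  card_set : D.card = k
  diff_count : ∀ g : G, g ≠ 1 →
    {d : G × G | d.1 ∈ D ∧ d.2 ∈ D ∧ g = d.1⁻¹ * d.2}.ncard = lam

/-- The development of `D`: the set of all left translates `g D`. -/
def development {G : Type} [Group G] (D : Finset G) : Set (Finset G) :=
  {T | ∃ g : G, T = D.map (Equiv.mulLeft g).toEmbedding}

open Classical in
/-- The cube `C (i₁, …, iₙ) = [g_{i₁} ⋯ g_{iₙ} ∈ D]`. -/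
noncomputable def differenceCube {G : Type} [Group G] (n : ℕ) {v : ℕ} (g : Fin v ≃ G)
    (D : Finset G) : Cube n v :=
  fun i => decide ((List.ofFn fun j => g (i j)).prod ∈ D)

open Classical in
/-- The cube `C (i₁, …, iₙ) = [g_{i₂} ⋯ g_{iₙ} ∈ B_{i₁}]` for `n ≥ 1`. There is no first index
for `n = 0`, where the value is irrelevant. -/
noncomputable def groupCube {G : Type} [Group G] (n : ℕ) {v : ℕ} (g : Fin v ≃ G)
    (B : Fin v → Finset G) : Cube n v :=
  match n with
  | 0 => fun _ => false
  | n + 1 => fun i => decide ((List.ofFn fun j : Fin n => g (i j.succ)).prod ∈ B (i 0))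

/-- Difference cubes: the cubes `differenceCube n g D` for a difference set `D`, with any
parameters, in any group of order `v`, with any ordering `g` of the group elements. -/
def IsDifferenceCube {n v : ℕ} (C : Cube n v) : Prop :=
  ∃ (G : Type) (_ : Group G) (g : Fin v ≃ G) (D : Finset G) (k lam : ℕ),
    IsDifferenceSet D v k lam ∧ C = differenceCube n g D

/-- Non-difference cubes: not equivalent to any difference cube. -/
def IsNonDifferenceCube {n v : ℕ} (C : Cube n v) : Prop :=
  ∀ C' : Cube n v, IsDifferenceCube C' → ¬ Equivalent C C'

/-- Group cubes: the cubes `groupCube n g B` for a `(v, k, lam)` design over a group of order `v`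
all of whose blocks are `(v, k, lam)` difference sets. -/
def IsGroupCube {n v : ℕ} (k lam : ℕ) (C : Cube n v) : Prop :=
  ∃ (G : Type) (_ : Group G) (g : Fin v ≃ G) (B : Fin v → Finset G),
    IsSymmetricDesign B v k lam ∧ (∀ j, IsDifferenceSet (B j) v k lam) ∧ C = groupCube n g B

/-- The Klein four-group `ℤ₂ × ℤ₂`, written multiplicatively. -/
abbrev Klein : Type := Multiplicative (ZMod 2 × ZMod 2)

/-- The elementary abelian group of order `4 ^ m`, as the `m`-th power of the Klein four-group. -/
abbrev ElemAb (m : ℕ) : Type := Fin m → Klein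

/-- The position `0, …, 15` of an element `abcd` of `ℤ₂⁴` in the lexicographic order. -/
def lexIndex (x : ElemAb 2) : ℕ :=
  8 * (Multiplicative.toAdd (x 0)).1.val + 4 * (Multiplicative.toAdd (x 0)).2.val
    + 2 * (Multiplicative.toAdd (x 1)).1.val + (Multiplicative.toAdd (x 1)).2.val

/-- The subset of `ℤ₂⁴` consisting of the elements with the given lexicographic positions. -/
def ofIndices (s : Finset ℕ) : Finset (ElemAb 2) :=
  Finset.univ.filter fun x => lexIndex x ∈ s

/-- The blocks `y D` of the development of the `(16, 6, 2)` difference set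
`D = {g₁, g₂, g₃, g₄, g₈, g₁₂}`. -/
def blocksD1 (y : ElemAb 2) : Finset (ElemAb 2) :=
  (ofIndices {1, 2, 3, 4, 8, 12}).map (Equiv.mulLeft y).toEmbedding

/-- The blocks of the once switched design: the blocks number `0, 1, 12, 13` are replaced by their
symmetric difference with `{g₂, g₃, g₁₄, g₁₅}`. -/
def blocksD2 (y : ElemAb 2) : Finset (ElemAb 2) :=
  if lexIndex y ∈ ({0, 1, 12, 13} : Finset ℕ) then
    symmDiff (blocksD1 y) (ofIndices {2, 3, 14, 15})
  else blocksD1 y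

/-- The blocks of the twice switched design: the blocks number `0, 1, 4, 5` of the once switched
design are replaced by their symmetric difference with `{g₆, g₇, g₁₄, g₁₅}`. -/
def blocksD3 (y : ElemAb 2) : Finset (ElemAb 2) :=
  if lexIndex y ∈ ({0, 1, 4, 5} : Finset ℕ) then
    symmDiff (blocksD2 y) (ofIndices {6, 7, 14, 15})
  else blocksD2 y

/-- The `4 × 4` block construction with `J - A` on the diagonal and `A` elsewhere, where `A` is the
incidence matrix of `B`. The last coordinate in the Klein four-group is the number of the block
row or block column. -/
def blockLift {m : ℕ} (B : ElemAb m → Finset (ElemAb m)) :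
    ElemAb (m + 1) → Finset (ElemAb (m + 1)) :=
  fun y => Finset.univ.filter fun x =>
    if x (Fin.last m) = y (Fin.last m) then Fin.init x ∉ B (Fin.init y)
    else Fin.init x ∈ B (Fin.init y)

/-- The series of designs over `ElemAb m`, `m ≥ 2`, obtained from `B` over `ElemAb 2` by repeating
the block construction `m - 2` times. The values for `m < 2` are irrelevant. -/
def liftedBlocks (B : ElemAb 2 → Finset (ElemAb 2)) : (m : ℕ) → ElemAb m → Finset (ElemAb m)
  | 0 => fun _ => ∅
  | 1 => fun _ => ∅
  | 2 => B
  | m + 3 => blockLift (liftedBlocks B (m + 2))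

/-- `B` lists the blocks of a symmetric `(v, k, lam)` design over `G` all of whose blocks are
`(v, k, lam)` difference sets in `G`, but which is not the development of any difference set
in `G`. -/
def IsNonDevelopedDifferenceSetDesign {G : Type} [Group G] (B : G → Finset G) (v k lam : ℕ) :
    Prop :=
  IsSymmetricDesign B v k lam ∧ (∀ y, IsDifferenceSet (B y) v k lam) ∧
    ∀ (D : Finset G) (k' lam' : ℕ), IsDifferenceSet D v k' lam' → Set.range B ≠ development D

end DesignCube

/-! An equivalence of cubes carries 2-dimensional slices to slices up to permutations of rows and
columns, so an isotopy invariant of 0/1 matrices can separate cubes. The invariant here is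
`closure`, the number of closed pairs of rows times that of columns; the product makes it blind to
transposition. All slices of a difference cube are isotopic to the matrix [ab ∈ D] or its transpose,
hence share one closure. In a group cube over an abelian group, the slices through the first
coordinate give the design or its transpose, and the others give the translates of a single block.
In ℤ₂⁴ the blocks are quadratic bent functions: their second differences are constant, so all 256
pairs are closed and the translates have closure 256². The two switched designs have closure only
64² and 32². Unequal values inside one cube exclude difference cubes, and 64² occurs in no slice of
the second cube. In terms of signs, the lift is a Kronecker product with a 4 × 4 matrix
(`blockMatrix_blockLift`). Closure is multiplicative (`closure_tensor`) and each step multiplies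
every value by 256, so the values stay distinct. Sums, orthogonality and autocorrelation also
multiply (`IsBentFamily.tensor`), which gives the design and difference set properties. A
development is closed under translation; this property descends through the lift and fails for both
base designs. -/

namespace DesignCube

/-! ### Sign matrices, Kronecker products and the closure invariant -/

section Matrices

variable {α β γ δ : Type*}

/-- The sign `(-1) ^ b`. -/
def sgn (b : Bool) : ℤ := if b then -1 else 1

lemma sgn_xor (a b : Bool) : sgn (a ^^ b) = sgn a * sgn b := by
  cases a <;> cases b <;> rfl

lemma sum_sgn [Fintype α] (p : α → Bool) :
    ∑ i, sgn (p i) = Fintype.card α - 2 * ((Finset.univ.filter fun i => p i = true).card : ℤ) := by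
  have h : ∀ i, sgn (p i) = 1 - 2 * (if p i = true then (1 : ℤ) else 0) := by
    intro i
    cases p i <;> rfl
  simp only [h, Finset.sum_sub_distrib, ← Finset.mul_sum, Finset.sum_boole]
  simp

lemma sum_sgn_mul_sgn [Fintype α] (p q : α → Bool) :
    ∑ i, sgn (p i) * sgn (q i) = Fintype.card α
      - 2 * ((Finset.univ.filter fun i => p i = true).card : ℤ)
      - 2 * ((Finset.univ.filter fun i => q i = true).card : ℤ)
      + 4 * ((Finset.univ.filter fun i => p i = true ∧ q i = true).card : ℤ) := by
  have h : ∀ i, sgn (p i) * sgn (q i) = 1 - 2 * (if p i = true then (1 : ℤ) else 0)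
      - 2 * (if q i = true then (1 : ℤ) else 0)
      + 4 * (if p i = true ∧ q i = true then (1 : ℤ) else 0) := by
    intro i
    cases p i <;> cases q i <;> rfl
  simp only [h, Finset.sum_sub_distrib, Finset.sum_add_distrib, ← Finset.mul_sum,
    Finset.sum_boole]
  simp

/-- Two matrices are isotopic if they agree up to bijections of the rows and of the columns. -/
def Isotopic (M : α → β → Bool) (N : γ → δ → Bool) : Prop :=
  ∃ (σ : α ≃ γ) (τ : β ≃ δ), ∀ i j, M i j = N (σ i) (τ j)

lemma Isotopic.symm {M : α → β → Bool} {N : γ → δ → Bool} (h : Isotopic M N) :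
    Isotopic N M := by
  obtain ⟨σ, τ, h⟩ := h
  exact ⟨σ.symm, τ.symm, fun i j => by simp [h]⟩

lemma Isotopic.flip {M : α → β → Bool} {N : γ → δ → Bool} (h : Isotopic M N) :
    Isotopic (flip M) (flip N) := by
  obtain ⟨σ, τ, h⟩ := h
  exact ⟨τ, σ, fun i j => h j i⟩

/-- The Kronecker product of sign matrices, in terms of their exponents. -/
def tensor (M : α → β → Bool) (H : γ → δ → Bool) : α × γ → β × δ → Bool :=
  fun i j => M i.1 j.1 ^^ H i.2 j.2

/-- A matrix with constant row and column sums and pairwise orthogonal rows (all in terms of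
signs). -/
structure IsMenon [Fintype α] [Fintype β] (M : α → β → Bool) (s : ℤ) : Prop where
  row_sum : ∀ i, ∑ j, sgn (M i j) = s
  col_sum : ∀ j, ∑ i, sgn (M i j) = s
  row_orthogonal : ∀ i i', i ≠ i' → ∑ j, sgn (M i j) * sgn (M i' j) = 0

lemma IsMenon.of_isotopic [Fintype α] [Fintype β] [Fintype γ] [Fintype δ]
    {M : α → β → Bool} {N : γ → δ → Bool} {s : ℤ} (h : Isotopic M N) (hN : IsMenon N s) :
    IsMenon M s := by
  obtain ⟨σ, τ, h⟩ := h
  refine ⟨fun i => ?_, fun j => ?_, fun i i' hi => ?_⟩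
  · rw [← hN.row_sum (σ i), ← Equiv.sum_comp τ]
    simp only [h]
  · rw [← hN.col_sum (τ j), ← Equiv.sum_comp σ]
    simp only [h]
  · rw [← hN.row_orthogonal (σ i) (σ i') (σ.injective.ne hi), ← Equiv.sum_comp τ]
    simp only [h]

lemma sum_tensor [Fintype β] [Fintype δ] (p : β → ℤ) (q : δ → ℤ) :
    ∑ j : β × δ, p j.1 * q j.2 = (∑ j, p j) * ∑ j, q j := by
  rw [Finset.sum_mul_sum, Fintype.sum_prod_type]

lemma IsMenon.tensor [Fintype α] [Fintype β] [Fintype γ] [Fintype δ]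
    {M : α → β → Bool} {H : γ → δ → Bool} {s t : ℤ} (hM : IsMenon M s) (hH : IsMenon H t) :
    IsMenon (tensor M H) (s * t) := by
  refine ⟨fun i => ?_, fun j => ?_, fun i i' hi => ?_⟩
  · simp only [DesignCube.tensor, sgn_xor]
    rw [sum_tensor (fun j => sgn (M i.1 j)) (fun j => sgn (H i.2 j)), hM.row_sum, hH.row_sum]
  · simp only [DesignCube.tensor, sgn_xor]
    rw [sum_tensor (fun i => sgn (M i j.1)) (fun i => sgn (H i j.2)), hM.col_sum, hH.col_sum]
  · simp only [DesignCube.tensor, sgn_xor]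
    simp only [mul_mul_mul_comm]
    rw [sum_tensor (fun j => sgn (M i.1 j) * sgn (M i'.1 j))
      (fun j => sgn (H i.2 j) * sgn (H i'.2 j))]
    by_cases h1 : i.1 = i'.1
    · rw [hH.row_orthogonal _ _ fun h2 => hi (Prod.ext h1 h2), mul_zero]
    · rw [hM.row_orthogonal _ _ h1, zero_mul]

/-- Points are rows and blocks are columns. The sum of signs of a column is v - 2k, and
orthogonality of two rows reads v - 4k + 4λ = 0; the numerical hypotheses say that these equations
have the solution (k, λ). -/
lemma IsMenon.isSymmetricDesign {P ι : Type} [Fintype P] [Fintype ι] {M : P → ι → Bool}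
    {s : ℤ} (h : IsMenon M s) {B : ι → Finset P} (hB : ∀ i j, i ∈ B j ↔ M i j = true)
    {v k lam : ℕ} (hP : Fintype.card P = v) (hι : Fintype.card ι = v)
    (hk : (v : ℤ) = 2 * k + s) (hlam : (v : ℤ) = 4 * lam + 2 * s) :
    IsSymmetricDesign B v k lam := by
  refine ⟨by simpa, by simpa, fun j => ?_, fun p q hpq => ?_⟩
  · have h1 := h.col_sum j
    have h2 : B j = Finset.univ.filter fun i => M i j = true := by
      ext i
      simp [hB]
    rw [sum_sgn, hP] at h1
    rw [h2]
    omega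
  · have h1 := h.row_orthogonal p q hpq
    have hp := h.row_sum p
    have hq := h.row_sum q
    rw [sum_sgn_mul_sgn] at h1
    rw [sum_sgn] at hp hq
    have h2 : {j : ι | p ∈ B j ∧ q ∈ B j} =
        ((Finset.univ.filter fun j => M p j = true ∧ M q j = true : Finset ι) : Set ι) := by
      ext j
      simp [hB]
    rw [h2, Set.ncard_coe_finset]
    rw [hι] at h1 hp hq
    omega

/-- The number of pairs of rows that occur, up to complementation, as the sum of two rows together
with every third row. -/
noncomputable def closedPairs (M : α → β → Bool) : ℕ :=
  Nat.card {p : α × α // ∀ c, ∃ d, ∀ x x',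
    (M p.1 x ^^ M p.2 x ^^ M c x ^^ M d x) = (M p.1 x' ^^ M p.2 x' ^^ M c x' ^^ M d x')}

lemma Isotopic.closedPairs_eq {M : α → β → Bool} {N : γ → δ → Bool} (h : Isotopic M N) :
    closedPairs M = closedPairs N := by
  obtain ⟨σ, τ, h⟩ := h
  refine Nat.card_congr ((Equiv.prodCongr σ σ).subtypeEquiv fun p => ?_)
  simp only [h, Equiv.prodCongr_apply, Prod.map_fst, Prod.map_snd]
  rw [σ.forall_congr_left]
  simp only [σ.symm.exists_congr_left, τ.forall_congr_left, Equiv.apply_symm_apply,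
    Equiv.symm_symm]

/-- A fourfold sum of rows of the product is f(x) + g(x'), which is constant exactly when f and g
both are. This is why closed pairs are taken up to complementation: requiring the sum to vanish
would not split over the factors. -/
lemma closedPairs_tensor [Nonempty β] [Nonempty δ] [Nonempty α] [Nonempty γ]
    (M : α → β → Bool) (H : γ → δ → Bool) :
    closedPairs (tensor M H) = closedPairs M * closedPairs H := by
  unfold closedPairs
  rw [← Nat.card_prod]
  have key : ∀ a b c d a' b' c' d' : Bool,
      ((a ^^ a') ^^ (b ^^ b') ^^ (c ^^ c') ^^ (d ^^ d')) =
        ((a ^^ b ^^ c ^^ d) ^^ (a' ^^ b' ^^ c' ^^ d')) := by decide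
  have cancel_right : ∀ a b c : Bool, (a ^^ c) = (b ^^ c) → a = b := by decide
  have cancel_left : ∀ a b c : Bool, (c ^^ a) = (c ^^ b) → a = b := by decide
  refine Nat.card_congr (((Equiv.prodProdProdComm α γ α γ).subtypeEquiv
    (q := fun p => _ ∧ _) fun p => ?_).trans (Equiv.subtypeProdEquivProd))
  simp only [tensor, key, Prod.forall, Prod.exists, Equiv.prodProdProdComm_apply]
  refine ⟨fun h => ⟨fun c => ?_, fun c => ?_⟩, fun h c c' => ?_⟩
  · obtain ⟨d, d', hd⟩ := h c (Classical.arbitrary γ)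
    exact ⟨d, fun x x' => cancel_right _ _ _
      (hd x (Classical.arbitrary δ) x' (Classical.arbitrary δ))⟩
  · obtain ⟨d, d', hd⟩ := h (Classical.arbitrary α) c
    exact ⟨d', fun x x' => cancel_left _ _ _
      (hd (Classical.arbitrary β) x (Classical.arbitrary β) x')⟩
  · obtain ⟨d, hd⟩ := h.1 c
    obtain ⟨d', hd'⟩ := h.2 c'
    exact ⟨d, d', fun x y x' y' => by rw [hd x x', hd' y y']⟩

/-- The number of closed pairs of rows times the number of closed pairs of columns. -/
noncomputable def closure (M : α → β → Bool) : ℕ := closedPairs M * closedPairs (flip M)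

lemma closure_flip (M : α → β → Bool) : closure (flip M) = closure M :=
  Nat.mul_comm _ _

lemma Isotopic.closure_eq {M : α → β → Bool} {N : γ → δ → Bool} (h : Isotopic M N) :
    closure M = closure N := by
  rw [closure, closure, h.closedPairs_eq, h.flip.closedPairs_eq]

lemma closure_tensor [Nonempty α] [Nonempty β] [Nonempty γ] [Nonempty δ]
    (M : α → β → Bool) (H : γ → δ → Bool) :
    closure (tensor M H) = closure M * closure H := by
  have h : flip (tensor M H) = tensor (flip M) (flip H) := rfl
  rw [closure, h, closedPairs_tensor, closedPairs_tensor, closure, closure, mul_mul_mul_comm]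

end Matrices

/-! ### Slices of difference cubes and of group cubes -/

section Cubes

variable {n v : ℕ}

lemma Equivalent.exists_isotopic_slice {C C' : Cube n v} (h : Equivalent C C') {x y : Fin n}
    (hxy : x ≠ y) (f : Fin n → Fin v) :
    ∃ (x' y' : Fin n) (f' : Fin n → Fin v), x' ≠ y' ∧
      Isotopic (slice C x y f) (slice C' x' y' f') := by
  obtain ⟨α, γ, rfl⟩ := h
  refine ⟨γ⁻¹ x, γ⁻¹ y, fun j => α (γ j) (f (γ j)), (γ⁻¹).injective.ne hxy, α x, α y,
    fun a b => ?_⟩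
  simp only [slice, conjugate, isotope]
  congr 1
  funext j
  rcases eq_or_ne j y with rfl | hy
  · simp
  · rw [Function.update_of_ne hy, Function.update_of_ne ((γ⁻¹).injective.ne hy)]
    rcases eq_or_ne j x with rfl | hx
    · simp
    · rw [Function.update_of_ne hx, Function.update_of_ne ((γ⁻¹).injective.ne hx)]
      simp

lemma exists_prod_ofFn_update {G : Type*} [Group G] {ι : Type*} (g : ι → G) :
    ∀ {n : ℕ} (x : Fin n) (f : Fin n → ι), ∃ a b : G, ∀ s,
      (List.ofFn fun j => g (Function.update f x s j)).prod = a * g s * b := by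
  intro n
  induction n with
  | zero => exact fun x => x.elim0
  | succ n ih =>
    intro x f
    induction x using Fin.cases with
    | zero =>
      refine ⟨1, (List.ofFn fun j : Fin n => g (f j.succ)).prod, fun s => ?_⟩
      simp [List.ofFn_succ]
    | succ x =>
      obtain ⟨a, b, h⟩ := ih x (fun j => f j.succ)
      refine ⟨g (f 0) * a, b, fun s => ?_⟩
      have h1 : ∀ j : Fin n, Function.update f x.succ s j.succ =
          Function.update (fun j => f j.succ) x s j := by
        intro j
        simp [Function.update_apply]
      have h2 : Function.update f x.succ s 0 = f 0 :=
        Function.update_of_ne (Fin.succ_ne_zero x).symm _ _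
      rw [List.ofFn_succ, List.prod_cons, h2]
      simp only [h1, h, mul_assoc]

/-- The fixed factors before, between and after the two varying ones collapse to constants. -/
lemma exists_prod_ofFn_update_update {G : Type*} [Group G] {ι : Type*} (g : ι → G) :
    ∀ {n : ℕ} (x y : Fin n) (_ : x < y) (f : Fin n → ι), ∃ a b c : G, ∀ s t,
      (List.ofFn fun j => g (Function.update (Function.update f x s) y t j)).prod =
        a * g s * b * g t * c := by
  intro n
  induction n with
  | zero => exact fun x => x.elim0
  | succ n ih =>
    intro x y hxy f
    induction y using Fin.cases with
    | zero => exact absurd hxy (Fin.not_lt_zero x)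
    | succ y =>
      have h1 : ∀ (f : Fin (n + 1) → ι) (z : Fin n) t (j : Fin n),
          Function.update f z.succ t j.succ = Function.update (fun j => f j.succ) z t j := by
        intro f z t j
        simp [Function.update_apply]
      have h2 : ∀ (f : Fin (n + 1) → ι) (z : Fin n) t, Function.update f z.succ t 0 = f 0 :=
        fun f z t => Function.update_of_ne (Fin.succ_ne_zero z).symm _ _
      induction x using Fin.cases with
      | zero =>
        obtain ⟨a, b, h⟩ := exists_prod_ofFn_update g y (fun j => f j.succ)
        refine ⟨1, a, b, fun s t => ?_⟩
        rw [List.ofFn_succ, List.prod_cons, h2]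
        simp only [h1]
        simp [h, mul_assoc]
      | succ x =>
        obtain ⟨a, b, c, h⟩ := ih x y (Fin.succ_lt_succ_iff.mp hxy) (fun j => f j.succ)
        refine ⟨g (f 0) * a, b, c, fun s t => ?_⟩
        rw [List.ofFn_succ, List.prod_cons, h2, h2]
        simp only [h1, h, mul_assoc]

open Classical in
-- In a product a · g s · b · g t · c, the constants a, b are absorbed into the bijection for s and
-- c into the one for t. The group may be nonabelian, so the order of the two coordinates matters
-- and the reverse order yields the transpose.
lemma isotopic_slice_differenceCube {G : Type} [Group G] (g : Fin v ≃ G) (D : Finset G)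
    {x y : Fin n} (hxy : x ≠ y) (f : Fin n → Fin v) :
    Isotopic (slice (differenceCube n g D) x y f) (fun a b : G => decide (a * b ∈ D)) ∨
      Isotopic (slice (differenceCube n g D) x y f)
        (flip fun a b : G => decide (a * b ∈ D)) := by
  rcases lt_or_gt_of_ne hxy with h | h
  · left
    obtain ⟨a, b, c, habc⟩ := exists_prod_ofFn_update_update g x y h f
    refine ⟨(g.trans (Equiv.mulLeft a)).trans (Equiv.mulRight b), g.trans (Equiv.mulRight c),
      fun s t => ?_⟩
    simp [slice, differenceCube, habc, mul_assoc]
  · right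
    obtain ⟨a, b, c, habc⟩ := exists_prod_ofFn_update_update g y x h f
    refine ⟨g.trans (Equiv.mulRight c), (g.trans (Equiv.mulLeft a)).trans (Equiv.mulRight b),
      fun s t => ?_⟩
    simp only [slice, differenceCube, flip]
    rw [Function.update_comm hxy, habc]
    simp [mul_assoc]

lemma IsDifferenceCube.closure_slice_eq {C : Cube n v} (hC : IsDifferenceCube C) {x y x' y' : Fin n}
    (hxy : x ≠ y) (hxy' : x' ≠ y') (f f' : Fin n → Fin v) :
    closure (slice C x y f) = closure (slice C x' y' f') := by
  classical
  obtain ⟨G, _, g, D, k, lam, -, rfl⟩ := hC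
  have key : ∀ (x y : Fin n) (_ : x ≠ y) (f : Fin n → Fin v),
      closure (slice (differenceCube n g D) x y f) =
        closure (fun a b : G => decide (a * b ∈ D)) := by
    intro x y hxy f
    rcases isotopic_slice_differenceCube g D hxy f with h | h
    · exact h.closure_eq
    · rw [h.closure_eq, closure_flip]
  rw [key x y hxy f, key x' y' hxy' f']

variable {G : Type} [CommGroup G]

open Classical in
/-- The matrix whose rows are the indicators of the blocks. -/
noncomputable def blockMatrix (B : G → Finset G) : G → G → Bool := fun y x => decide (x ∈ B y)

lemma blockMatrix_eq_true {G : Type} {B : G → Finset G} {y x : G} :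
    blockMatrix B y x = true ↔ x ∈ B y := by
  simp [blockMatrix]

/-- The matrix of the translates of one row of `F`. -/
def translateMatrix (F : G → G → Bool) (y : G) : G → G → Bool := fun a b => F y (a * b)

lemma exists_prod_ofFn_update_eq_mul (g : Fin v → G) (x : Fin n) (f : Fin n → Fin v) :
    ∃ a : G, ∀ s, (List.ofFn fun j => g (Function.update f x s j)).prod = a * g s := by
  obtain ⟨a, b, h⟩ := exists_prod_ofFn_update g x f
  exact ⟨a * b, fun s => by rw [h, mul_right_comm]⟩

lemma update_succ_zero (f : Fin (n + 1) → Fin v) (z : Fin n) (a : Fin v) :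
    Function.update f z.succ a 0 = f 0 :=
  Function.update_of_ne (Fin.succ_ne_zero z).symm _ _

lemma update_succ_succ (f : Fin (n + 1) → Fin v) (z : Fin n) (a : Fin v) (j : Fin n) :
    Function.update f z.succ a j.succ = Function.update (fun j => f j.succ) z a j := by
  simp [Function.update_apply]

lemma isotopic_slice_groupCube_zero_succ (g : Fin v ≃ G) (B : G → Finset G) (y : Fin n)
    (f : Fin (n + 1) → Fin v) :
    Isotopic (slice (groupCube (n + 1) g fun i => B (g i)) 0 y.succ f) (blockMatrix B) := by
  obtain ⟨a, h⟩ := exists_prod_ofFn_update_eq_mul g y (fun j => f j.succ)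
  refine ⟨g, g.trans (Equiv.mulLeft a), fun s t => ?_⟩
  simp only [slice, groupCube, blockMatrix, decide_eq_decide]
  simp [update_succ_zero, update_succ_succ, h]

lemma isotopic_slice_groupCube_succ_zero (g : Fin v ≃ G) (B : G → Finset G) (y : Fin n)
    (f : Fin (n + 1) → Fin v) :
    Isotopic (slice (groupCube (n + 1) g fun i => B (g i)) y.succ 0 f)
      (flip (blockMatrix B)) := by
  obtain ⟨a, h⟩ := exists_prod_ofFn_update_eq_mul g y (fun j => f j.succ)
  refine ⟨g.trans (Equiv.mulLeft a), g, fun s t => ?_⟩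
  simp only [slice, groupCube, blockMatrix, flip, decide_eq_decide]
  simp [update_succ_succ, h]

/-- The first coordinate is fixed and selects the block; by commutativity the fixed factors form one
constant, whatever the order of the two varying coordinates. -/
lemma isotopic_slice_groupCube_succ_succ (g : Fin v ≃ G) (B : G → Finset G) {x y : Fin n}
    (hxy : x ≠ y) (f : Fin (n + 1) → Fin v) :
    Isotopic (slice (groupCube (n + 1) g fun i => B (g i)) x.succ y.succ f)
      (translateMatrix (blockMatrix B) (g (f 0))) := by
  have key : ∃ c : G, ∀ s t, (List.ofFn fun j => g (Function.update (Function.update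
      (fun j => f j.succ) x s) y t j)).prod = c * g s * g t := by
    rcases lt_or_gt_of_ne hxy with h | h
    · obtain ⟨a, b, c, habc⟩ := exists_prod_ofFn_update_update g x y h (fun j => f j.succ)
      exact ⟨a * b * c, fun s t => by rw [habc]; ac_rfl⟩
    · obtain ⟨a, b, c, habc⟩ := exists_prod_ofFn_update_update g y x h (fun j => f j.succ)
      exact ⟨a * b * c, fun s t => by rw [Function.update_comm hxy, habc]; ac_rfl⟩
  obtain ⟨c, h⟩ := key
  refine ⟨g.trans (Equiv.mulLeft c), g, fun s t => ?_⟩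
  simp only [slice, groupCube, blockMatrix, translateMatrix, decide_eq_decide]
  simp [update_succ_zero, update_succ_succ, h]

end Cubes

/-! ### Families of bent functions and their group cubes -/

section Families

variable {G H : Type} [CommGroup G] [CommGroup H]

/-- A family of sets whose matrix and its transpose have constant row sums and orthogonal rows, and
each of which has vanishing autocorrelation (all in terms of signs). -/
structure IsBentFamily [Fintype G] (F : G → G → Bool) (s : ℤ) : Prop where
  isMenon : IsMenon F s
  isMenon_flip : IsMenon (flip F) s
  autocorrelation : ∀ y g, g ≠ 1 → ∑ x, sgn (F y x) * sgn (F y (x * g)) = 0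

lemma IsBentFamily.tensor [Fintype G] [Fintype H] {F : G → G → Bool} {E : H → H → Bool}
    {s t : ℤ} (hF : IsBentFamily F s) (hE : IsBentFamily E t) :
    IsBentFamily (tensor F E) (s * t) := by
  refine ⟨hF.isMenon.tensor hE.isMenon, hF.isMenon_flip.tensor hE.isMenon_flip,
    fun y g hg => ?_⟩
  simp only [DesignCube.tensor, sgn_xor, Prod.fst_mul, Prod.snd_mul]
  refine (Finset.sum_congr rfl fun x _ => mul_mul_mul_comm _ _ _ _).trans ?_
  rw [sum_tensor (fun x => sgn (F y.1 x) * sgn (F y.1 (x * g.1)))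
    (fun x => sgn (E y.2 x) * sgn (E y.2 (x * g.2)))]
  by_cases h1 : g.1 = 1
  · rw [hE.autocorrelation _ _ fun h2 => hg (Prod.ext h1 h2), mul_zero]
  · rw [hF.autocorrelation _ _ h1, zero_mul]

lemma IsBentFamily.comp_mulEquiv [Fintype G] [Fintype H] {F : G → G → Bool} {s : ℤ}
    (hF : IsBentFamily F s) (e : H ≃* G) : IsBentFamily (fun y x => F (e y) (e x)) s := by
  refine ⟨.of_isotopic ⟨e.toEquiv, e.toEquiv, fun _ _ => rfl⟩ hF.isMenon,
    .of_isotopic ⟨e.toEquiv, e.toEquiv, fun _ _ => rfl⟩ hF.isMenon_flip, fun y g hg => ?_⟩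
  rw [← hF.autocorrelation (e y) (e g) (by simpa using hg), ← Equiv.sum_comp e.toEquiv]
  simp

/-- Row and column sums are the sum over one block. After a change of variable, the inner product of
the rows i and i' is the autocorrelation of that block at i' * i⁻¹. -/
lemma IsBentFamily.isMenon_translateMatrix [Fintype G] {F : G → G → Bool} {s : ℤ}
    (hF : IsBentFamily F s) (y : G) : IsMenon (translateMatrix F y) s := by
  refine ⟨fun i => ?_, fun j => ?_, fun i i' hi => ?_⟩
  · rw [← hF.isMenon.row_sum y, ← Equiv.sum_comp (Equiv.mulLeft i) fun x => sgn (F y x)]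
    rfl
  · rw [← hF.isMenon.row_sum y, ← Equiv.sum_comp (Equiv.mulRight j) fun x => sgn (F y x)]
    rfl
  · rw [← hF.autocorrelation y (i' * i⁻¹) (by simpa [mul_inv_eq_one] using hi.symm),
      ← Equiv.sum_comp (Equiv.mulLeft i) fun x => sgn (F y x) * sgn (F y (x * (i' * i⁻¹)))]
    refine Finset.sum_congr rfl fun x _ => ?_
    have h : i * x * (i' * i⁻¹) = i' * x := by
      rw [mul_comm i x, mul_comm i', mul_assoc, mul_inv_cancel_left, mul_comm]
    simp [translateMatrix, h]

/-- Every translate of a row of `F` is a row of `F`. -/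
def TranslationClosed (F : G → G → Bool) : Prop :=
  ∀ y g, ∃ y', ∀ x, F y (g * x) = F y' x

lemma translationClosed_of_range_eq_development {B : G → Finset G} {D : Finset G}
    (h : Set.range B = development D) : TranslationClosed (blockMatrix B) := by
  intro y g
  obtain ⟨a, ha⟩ : B y ∈ development D := h ▸ Set.mem_range_self y
  obtain ⟨y', hy'⟩ : D.map (Equiv.mulLeft (g⁻¹ * a)).toEmbedding ∈ Set.range B := h ▸ ⟨_, rfl⟩
  refine ⟨y', fun x => ?_⟩
  simp only [blockMatrix, decide_eq_decide, ha, hy', Finset.mem_map_equiv,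
    Equiv.mulLeft_symm_apply, mul_inv_rev, inv_inv, mul_assoc]

lemma IsBentFamily.isSymmetricDesign [Fintype G] {ι : Type} [Fintype ι] {B : G → Finset G}
    {s : ℤ} (hB : IsBentFamily (blockMatrix B) s) (e : ι ≃ G) {v k lam : ℕ}
    (hv : Fintype.card G = v) (hk : (v : ℤ) = 2 * k + s) (hlam : (v : ℤ) = 4 * lam + 2 * s) :
    IsSymmetricDesign (fun i => B (e i)) v k lam := by
  have h : IsMenon (fun (p : G) (i : ι) => blockMatrix B (e i) p) s :=
    .of_isotopic ⟨Equiv.refl G, e, fun _ _ => rfl⟩ hB.isMenon_flip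
  exact h.isSymmetricDesign (by simp [blockMatrix]) hv ((Fintype.card_congr e).trans hv) hk hlam

/-- The translates of `B y` form a symmetric design. The translates containing both 1 and g
correspond to the x with x and g * x in `B y`, that is, to the representations of g as a quotient
with d₁ = x. -/
lemma IsBentFamily.isDifferenceSet [Fintype G] {B : G → Finset G} {s : ℤ}
    (hB : IsBentFamily (blockMatrix B) s) {v k lam : ℕ} (hv : Fintype.card G = v)
    (hk : (v : ℤ) = 2 * k + s) (hlam : (v : ℤ) = 4 * lam + 2 * s) (y : G) :
    IsDifferenceSet (B y) v k lam := by
  have h := (hB.isMenon_translateMatrix y).isSymmetricDesign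
    (B := fun j => (B y).map (Equiv.mulRight j⁻¹).toEmbedding)
    (by simp [translateMatrix, blockMatrix]) hv hv hk hlam
  refine ⟨h.card_points, ?_, fun g hg => ?_⟩
  · simpa using h.block_card 1
  · rw [← h.pair_count 1 g hg.symm]
    have himage : {d : G × G | d.1 ∈ B y ∧ d.2 ∈ B y ∧ g = d.1⁻¹ * d.2} =
        (fun x => (x, g * x)) '' {x | x ∈ B y ∧ g * x ∈ B y} := by
      ext ⟨a, b⟩
      simp only [Set.mem_ofPred_eq, Set.mem_image, Prod.mk.injEq]
      constructor
      · rintro ⟨ha, hb, rfl⟩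
        exact ⟨a, ⟨ha, by simpa [mul_comm] using hb⟩, rfl, by simp [mul_comm]⟩
      · rintro ⟨x, ⟨hx, hgx⟩, rfl, rfl⟩
        exact ⟨hx, hgx, by simp [mul_comm]⟩
    rw [himage, Set.ncard_image_of_injective _ fun a b h => (Prod.mk.inj h).1]
    simp

lemma IsBentFamily.groupCube_mem_designCubes [Fintype G] {B : G → Finset G} {s : ℤ}
    (hB : IsBentFamily (blockMatrix B) s) {n v k lam : ℕ} (g : Fin v ≃ G)
    (hk : (v : ℤ) = 2 * k + s) (hlam : (v : ℤ) = 4 * lam + 2 * s) :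
    groupCube (n + 1) g (fun i => B (g i)) ∈ designCubes (n + 1) v k lam := by
  intro x y hxy f
  suffices h : IsMenon (slice (groupCube (n + 1) g fun i => B (g i)) x y f) s from
    h.isSymmetricDesign (by simp) (Fintype.card_fin v) (Fintype.card_fin v) hk hlam
  induction x using Fin.cases with
  | zero =>
    induction y using Fin.cases with
    | zero => exact absurd rfl hxy
    | succ y => exact hB.isMenon.of_isotopic (isotopic_slice_groupCube_zero_succ g B y f)
  | succ x =>
    induction y using Fin.cases with
    | zero => exact hB.isMenon_flip.of_isotopic (isotopic_slice_groupCube_succ_zero g B x f)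
    | succ y =>
      exact (hB.isMenon_translateMatrix _).of_isotopic
        (isotopic_slice_groupCube_succ_succ g B (fun h => hxy (congrArg Fin.succ h)) f)

/-- The closure of a slice of a group cube is that of the design or that of the translates of
a block. -/
lemma closure_slice_groupCube {n v : ℕ} (g : Fin v ≃ G) (B : G → Finset G) {x y : Fin (n + 1)}
    (hxy : x ≠ y) (f : Fin (n + 1) → Fin v) :
    closure (slice (groupCube (n + 1) g fun i => B (g i)) x y f) = closure (blockMatrix B) ∨
      ∃ z, closure (slice (groupCube (n + 1) g fun i => B (g i)) x y f) =
        closure (translateMatrix (blockMatrix B) z) := by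
  induction x using Fin.cases with
  | zero =>
    induction y using Fin.cases with
    | zero => exact absurd rfl hxy
    | succ y => exact .inl (isotopic_slice_groupCube_zero_succ g B y f).closure_eq
  | succ x =>
    induction y using Fin.cases with
    | zero =>
      exact .inl ((isotopic_slice_groupCube_succ_zero g B x f).closure_eq.trans (closure_flip _))
    | succ y =>
      exact .inr ⟨_, (isotopic_slice_groupCube_succ_succ g B
        (fun h => hxy (congrArg Fin.succ h)) f).closure_eq⟩

/-- Coordinates 0, 1 give a slice isotopic to the design, and coordinates 1, 2 one isotopic to the
translates of a block. The second pair needs dimension at least 3. -/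
lemma isNonDifferenceCube_groupCube {n v : ℕ} (g : Fin v ≃ G) (B : G → Finset G)
    (hB : ∀ z, closure (translateMatrix (blockMatrix B) z) ≠ closure (blockMatrix B)) :
    IsNonDifferenceCube (groupCube (n + 3) g fun i => B (g i)) := by
  intro C' hC' h
  have f : Fin (n + 3) → Fin v := fun _ => g.symm 1
  have h0 : (0 : Fin (n + 3)) ≠ Fin.succ 0 := (Fin.succ_ne_zero 0).symm
  have h1 : (Fin.succ 0 : Fin (n + 3)) ≠ Fin.succ 1 :=
    (Fin.succ_injective _).ne Fin.zero_ne_one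
  obtain ⟨x, y, f', hxy, hs⟩ := h.exists_isotopic_slice h0 f
  obtain ⟨x', y', f'', hxy', hs'⟩ := h.exists_isotopic_slice h1 f
  refine hB (g (f 0)) ?_
  rw [← (isotopic_slice_groupCube_zero_succ g B 0 f).closure_eq,
    ← (isotopic_slice_groupCube_succ_succ g B Fin.zero_ne_one f).closure_eq,
    hs.closure_eq, hs'.closure_eq]
  exact hC'.closure_slice_eq hxy' hxy _ _

lemma not_equivalent_groupCube {n v : ℕ} (g : Fin v ≃ G) (B B' : G → Finset G)
    (hB : closure (blockMatrix B') ≠ closure (blockMatrix B))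
    (hB' : ∀ z, closure (translateMatrix (blockMatrix B') z) ≠ closure (blockMatrix B)) :
    ¬ Equivalent (groupCube (n + 2) g fun i => B (g i))
      (groupCube (n + 2) g fun i => B' (g i)) := by
  intro h
  have f : Fin (n + 2) → Fin v := fun _ => g.symm 1
  obtain ⟨x, y, f', hxy, hs⟩ :=
    h.exists_isotopic_slice (Fin.succ_ne_zero (0 : Fin (n + 1))).symm f
  have h0 := (isotopic_slice_groupCube_zero_succ g B 0 f).closure_eq
  rw [hs.closure_eq] at h0
  rcases closure_slice_groupCube g B' hxy f' with h1 | ⟨z, h1⟩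
  · exact hB (h1.symm.trans h0)
  · exact hB' z (h1.symm.trans h0)

end Families

/-! ### The lift as a Kronecker product with a matrix over the Klein group -/

section Lift

/-- The `4 × 4` identity matrix, with rows and columns indexed by the Klein four-group. -/
def kleinMatrix : Klein → Klein → Bool := fun t s => decide (s = t)

/-- Splitting off the last coordinate. -/
def splitLast (m : ℕ) : ElemAb (m + 1) ≃* ElemAb m × Klein where
  toFun x := (Fin.init x, x (Fin.last m))
  invFun p := Fin.snoc (α := fun _ => Klein) p.1 p.2
  left_inv x := Fin.snoc_init_self x
  right_inv p := by simp
  map_mul' _ _ := rfl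

@[simp]
lemma splitLast_fst {m : ℕ} (x : ElemAb (m + 1)) : (splitLast m x).1 = Fin.init x := rfl

@[simp]
lemma splitLast_snd {m : ℕ} (x : ElemAb (m + 1)) : (splitLast m x).2 = x (Fin.last m) := rfl

lemma blockMatrix_blockLift {m : ℕ} (B : ElemAb m → Finset (ElemAb m)) :
    blockMatrix (blockLift B) = fun y x =>
      tensor (blockMatrix B) kleinMatrix (splitLast m y) (splitLast m x) := by
  funext y x
  rw [Bool.eq_iff_iff]
  by_cases h : x (Fin.last m) = y (Fin.last m) <;>
    simp [blockMatrix_eq_true, blockLift, tensor, kleinMatrix, h, ← Bool.not_eq_true]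

lemma isBentFamily_kleinMatrix : IsBentFamily kleinMatrix 2 :=
  ⟨⟨by decide, by decide, by decide⟩, ⟨by decide, by decide, by decide⟩, by decide⟩

lemma IsBentFamily.blockLift {m : ℕ} {B : ElemAb m → Finset (ElemAb m)} {s : ℤ}
    (hB : IsBentFamily (blockMatrix B) s) :
    IsBentFamily (blockMatrix (blockLift B)) (s * 2) := by
  rw [blockMatrix_blockLift]
  exact (hB.tensor isBentFamily_kleinMatrix).comp_mulEquiv (splitLast m)

lemma closure_blockLift {m : ℕ} (B : ElemAb m → Finset (ElemAb m)) :
    closure (blockMatrix (blockLift B)) = closure (blockMatrix B) * closure kleinMatrix := by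
  rw [← closure_tensor, blockMatrix_blockLift]
  exact Isotopic.closure_eq ⟨(splitLast m).toEquiv, (splitLast m).toEquiv, fun _ _ => rfl⟩

lemma closure_translateMatrix_blockLift {m : ℕ} (B : ElemAb m → Finset (ElemAb m))
    (y : ElemAb (m + 1)) :
    closure (translateMatrix (blockMatrix (blockLift B)) y) =
      closure (translateMatrix (blockMatrix B) (Fin.init y)) *
        closure (translateMatrix kleinMatrix (y (Fin.last m))) := by
  rw [← closure_tensor, blockMatrix_blockLift]
  exact Isotopic.closure_eq ⟨(splitLast m).toEquiv, (splitLast m).toEquiv, fun _ _ => rfl⟩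

lemma TranslationClosed.of_blockLift {m : ℕ} {B : ElemAb m → Finset (ElemAb m)}
    (h : TranslationClosed (blockMatrix (blockLift B))) : TranslationClosed (blockMatrix B) := by
  intro y g
  obtain ⟨y', hy'⟩ := h ((splitLast m).symm (y, 1)) ((splitLast m).symm (g, 1))
  -- A column s outside the diagonal position of both rows, so that the lift complements neither of
  -- the entries compared.
  have hs : ∀ t : Klein, ∃ s : Klein, s ≠ 1 ∧ s ≠ t := by decide
  obtain ⟨s, hs1, hst⟩ := hs (y' (Fin.last m))
  refine ⟨(splitLast m y').1, fun x => ?_⟩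
  have hx := hy' ((splitLast m).symm (x, s))
  rw [blockMatrix_blockLift] at hx
  simpa [tensor, kleinMatrix, hs1, hst] using hx

lemma closedPairs_eq_card {α β : Type*} [Fintype α] {M : α → β → Bool}
    (h : ∀ a b c, ∃ d, ∀ x x',
      (M a x ^^ M b x ^^ M c x ^^ M d x) = (M a x' ^^ M b x' ^^ M c x' ^^ M d x')) :
    closedPairs M = Fintype.card α * Fintype.card α := by
  have h' : ∀ p : α × α, ∀ c, ∃ d, ∀ x x',
      (M p.1 x ^^ M p.2 x ^^ M c x ^^ M d x) = (M p.1 x' ^^ M p.2 x' ^^ M c x' ^^ M d x') :=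
    fun p => h p.1 p.2
  rw [closedPairs, Nat.card_congr (Equiv.subtypeUnivEquiv h'), Nat.card_eq_fintype_card,
    Fintype.card_prod]

/-- Three distinct rows of the identity matrix and the fourth one sum to all ones; if two of the
three rows coincide, the remaining one serves as the fourth. So all 16 pairs are closed. -/
lemma closure_kleinMatrix : closure kleinMatrix = 16 * 16 := by
  rw [closure, closedPairs_eq_card (by decide), closedPairs_eq_card (by decide)]
  rfl

lemma closure_translateMatrix_kleinMatrix (t : Klein) :
    closure (translateMatrix kleinMatrix t) = 16 * 16 := by
  have h : Isotopic (translateMatrix kleinMatrix t) kleinMatrix := by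
    -- The Klein group has exponent 2, so a * b = t means b = t * a.
    refine ⟨Equiv.mulLeft t, Equiv.refl _, fun a b => ?_⟩
    revert t a b
    decide
  rw [h.closure_eq, closure_kleinMatrix]

variable {B : ElemAb 2 → Finset (ElemAb 2)}

lemma isBentFamily_liftedBlocks (hB : IsBentFamily (blockMatrix B) 4) (m : ℕ) :
    IsBentFamily (blockMatrix (liftedBlocks B (m + 2))) (2 ^ (m + 2)) := by
  induction m with
  | zero => exact hB
  | succ m ih => exact ih.blockLift

lemma not_translationClosed_liftedBlocks (hB : ¬ TranslationClosed (blockMatrix B)) (m : ℕ) :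
    ¬ TranslationClosed (blockMatrix (liftedBlocks B (m + 2))) := by
  induction m with
  | zero => exact hB
  | succ m ih => exact fun h => ih h.of_blockLift

lemma closure_liftedBlocks (B : ElemAb 2 → Finset (ElemAb 2)) (m : ℕ) :
    closure (blockMatrix (liftedBlocks B (m + 2))) = closure (blockMatrix B) * 256 ^ m := by
  induction m with
  | zero => simp [liftedBlocks]
  | succ m ih =>
    refine (closure_blockLift _).trans ?_
    rw [ih, closure_kleinMatrix, pow_succ, mul_assoc]

lemma closure_translateMatrix_liftedBlocks {c : ℕ}
    (hB : ∀ y, closure (translateMatrix (blockMatrix B) y) = c) (m : ℕ) (y : ElemAb (m + 2)) :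
    closure (translateMatrix (blockMatrix (liftedBlocks B (m + 2))) y) = c * 256 ^ m := by
  induction m with
  | zero => simpa [liftedBlocks] using hB y
  | succ m ih =>
    refine (closure_translateMatrix_blockLift _ _).trans ?_
    rw [ih, closure_translateMatrix_kleinMatrix, pow_succ, mul_assoc]

end Lift

/-! ### The two base designs over ℤ₂⁴, computed with bit masks -/

section Base

lemma lexIndex_lt (x : ElemAb 2) : lexIndex x < 16 := by
  revert x
  decide +kernel

lemma lexIndex_injective : Function.Injective lexIndex := by
  decide +kernel

lemma lexIndex_mul (x y : ElemAb 2) : lexIndex (x * y) = lexIndex x ^^^ lexIndex y := by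
  revert x y
  decide +kernel

/-- The lexicographic numbering of `ℤ₂⁴`. -/
noncomputable def lexEquiv : ElemAb 2 ≃ Fin 16 :=
  Equiv.ofBijective (fun x => ⟨lexIndex x, lexIndex_lt x⟩)
    ((Fintype.bijective_iff_injective_and_card _).2
      ⟨fun _ _ h => lexIndex_injective (Fin.mk.inj h), by decide +kernel⟩)

/-- The blocks of `blocksD2` as bit masks. -/
def masksD2 : List ℕ :=
  [53522, 57889, 17483, 34951, 4577, 8914, 17588, 34936, 7697, 11554, 19268, 34696, 8477, 4654,
    46148, 30856]

/-- The blocks of `blocksD3` as bit masks. -/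
def masksD3 : List ℕ :=
  [4562, 8929, 17483, 34951, 53537, 57874, 17588, 34936, 7697, 11554, 19268, 34696, 8477, 4654,
    46148, 30856]

/-- The matrix with the bit masks `L` as its rows. -/
def maskMatrix (L : List ℕ) : Fin 16 → Fin 16 → Bool := fun y x => (L.getD y 0).testBit x

lemma mem_blocksD2 : ∀ x y : ElemAb 2,
    x ∈ blocksD2 y ↔ (masksD2.getD (lexIndex y) 0).testBit (lexIndex x) = true := by
  decide +kernel

lemma mem_blocksD3 : ∀ x y : ElemAb 2,
    x ∈ blocksD3 y ↔ (masksD3.getD (lexIndex y) 0).testBit (lexIndex x) = true := by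
  decide +kernel

lemma val_lexEquiv (x : ElemAb 2) : (lexEquiv x : ℕ) = lexIndex x := rfl

/-- The bit mask `a` translated by the elements of the group of numbers below `16` with bitwise
addition. -/
def xorMatrix (a : ℕ) : Fin 16 → Fin 16 → Bool := fun y x => a.testBit (y.val ^^^ x.val)

/-- Transport along the lexicographic numbering, where the group law is bitwise xor: what is left is
a finite check on natural numbers that the kernel evaluates quickly. -/
lemma isBentFamily_of_masks {F : ElemAb 2 → ElemAb 2 → Bool} {L : List ℕ} {s : ℤ}
    (hF : ∀ y x, F y x = maskMatrix L (lexEquiv y) (lexEquiv x))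
    (h : IsMenon (maskMatrix L) s) (hflip : IsMenon (flip (maskMatrix L)) s)
    (hcorr : ∀ y g : Fin 16, g ≠ 0 →
      ∑ x : Fin 16, sgn (maskMatrix L y x) * sgn (xorMatrix (L.getD y 0) x g) = 0) :
    IsBentFamily F s := by
  have hiso : Isotopic F (maskMatrix L) := ⟨lexEquiv, lexEquiv, hF⟩
  refine ⟨h.of_isotopic hiso, hflip.of_isotopic hiso.flip, fun y g hg => ?_⟩
  have h1 : lexEquiv (1 : ElemAb 2) = 0 := by
    apply Fin.ext
    rw [val_lexEquiv]
    decide +kernel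
  rw [← hcorr (lexEquiv y) (lexEquiv g) fun h0 => hg (lexEquiv.injective (h0.trans h1.symm)),
    ← Equiv.sum_comp lexEquiv]
  refine Finset.sum_congr rfl fun x _ => ?_
  rw [hF, hF, maskMatrix, maskMatrix, xorMatrix, val_lexEquiv (x * g), lexIndex_mul]
  rfl

lemma isotopic_translateMatrix_of_masks {F : ElemAb 2 → ElemAb 2 → Bool} {L : List ℕ}
    (hF : ∀ y x, F y x = maskMatrix L (lexEquiv y) (lexEquiv x)) (y : ElemAb 2) :
    Isotopic (translateMatrix F y) (xorMatrix (L.getD (lexEquiv y) 0)) := by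
  refine ⟨lexEquiv, lexEquiv, fun a b => ?_⟩
  rw [translateMatrix, hF, maskMatrix, xorMatrix, val_lexEquiv (a * b), lexIndex_mul]
  rfl

lemma not_translationClosed_of_masks {F : ElemAb 2 → ElemAb 2 → Bool} {L : List ℕ}
    (hF : ∀ y x, F y x = maskMatrix L (lexEquiv y) (lexEquiv x))
    (hL : ∃ y g : Fin 16, ∀ y' : Fin 16, ∃ x : Fin 16,
      xorMatrix (L.getD y 0) g x ≠ maskMatrix L y' x) : ¬ TranslationClosed F := by
  obtain ⟨y, g, h⟩ := hL
  intro hF'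
  obtain ⟨y', hy'⟩ := hF' (lexEquiv.symm y) (lexEquiv.symm g)
  obtain ⟨x, hx⟩ := h (lexEquiv y')
  apply hx
  have h1 := hy' (lexEquiv.symm x)
  rw [hF, hF, maskMatrix, val_lexEquiv (_ * _), lexIndex_mul, ← val_lexEquiv, ← val_lexEquiv] at h1
  simpa [xorMatrix] using h1

/-! ### Second differences and the closure of the translates of a block -/

lemma val_xor (x y : Fin 16) : (x ^^^ y : Fin 16).val = x.val ^^^ y.val := by
  revert x y
  decide +kernel

lemma exists_eq_xor (p : Fin 16) : ∃ a b c d : Fin 16, (a = 0 ∨ a = 1) ∧ (b = 0 ∨ b = 2) ∧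
    (c = 0 ∨ c = 4) ∧ (d = 0 ∨ d = 8) ∧ p.val = a.val ^^^ b.val ^^^ c.val ^^^ d.val := by
  revert p
  decide +kernel

/-- The second difference of the function with bit mask `a`. -/
def secondDifference (a p q x : ℕ) : Bool :=
  a.testBit x ^^ a.testBit (x ^^^ p) ^^ a.testBit (x ^^^ q) ^^ a.testBit (x ^^^ p ^^^ q)

lemma secondDifference_zero (a q x : ℕ) : secondDifference a 0 q x = false := by
  simp [secondDifference]

/-- Cocycle identity: the terms at x + p and x + p + q occur twice and cancel. The second summand is
based at x + p. -/
lemma secondDifference_xor (a p p' q x : ℕ) : secondDifference a (p ^^^ p') q x =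
    (secondDifference a p q x ^^ secondDifference a p' q (x ^^^ p)) := by
  have h1 : x ^^^ (p ^^^ p') = x ^^^ p ^^^ p' := (Nat.xor_assoc _ _ _).symm
  have h2 : x ^^^ q ^^^ p = x ^^^ p ^^^ q := Nat.xor_right_comm _ _ _
  simp only [secondDifference, h1]
  grind

/-- By the cocycle identity, constancy in x for two directions passes to their sum, so it suffices
to test the four basis directions. This keeps the later kernel check small. -/
lemma secondDifference_eq_of_basis {a : ℕ} (ha : ∀ p : Fin 16, (p = 1 ∨ p = 2 ∨ p = 4 ∨ p = 8) →
      ∀ q x : Fin 16, secondDifference a p q x = secondDifference a p q 0) (p q x : Fin 16) :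
    secondDifference a p q x = secondDifference a p q 0 := by
  have hbasis : ∀ {b e : Fin 16}, b = 0 ∨ b = e → (e = 1 ∨ e = 2 ∨ e = 4 ∨ e = 8) →
      ∀ x : Fin 16, secondDifference a b q x = secondDifference a b q 0 := by
    rintro b e (rfl | rfl) he x
    · rw [Fin.val_zero, secondDifference_zero, secondDifference_zero]
    · exact ha b he q x
  have hxor : ∀ b c : ℕ, b < 16 →
      (∀ x : Fin 16, secondDifference a b q x = secondDifference a b q 0) →
      (∀ x : Fin 16, secondDifference a c q x = secondDifference a c q 0) →
      ∀ x : Fin 16, secondDifference a (b ^^^ c) q x = secondDifference a (b ^^^ c) q 0 := by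
    intro b c hb hb' hc' x
    have h1 := hc' ⟨x ^^^ b, Nat.xor_lt_two_pow (n := 4) x.isLt hb⟩
    have h2 := hc' ⟨0 ^^^ b, Nat.xor_lt_two_pow (n := 4) (by norm_num) hb⟩
    rw [secondDifference_xor, secondDifference_xor, hb' x, h1, h2]
  obtain ⟨b, c, d, e, hb, hc, hd, he, h⟩ := exists_eq_xor p
  rw [h]
  have lt {x y : ℕ} (hx : x < 16) (hy : y < 16) : x ^^^ y < 16 :=
    Nat.xor_lt_two_pow (n := 4) hx hy
  exact hxor _ _ (lt (lt b.isLt c.isLt) d.isLt) (hxor _ _ (lt b.isLt c.isLt)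
    (hxor _ _ b.isLt (hbasis hb (by simp)) (hbasis hc (by simp))) (hbasis hd (by simp)))
    (hbasis he (by simp)) x

/-- If the second differences are constant, then the sum of any three rows of the matrix of
translates is a row, up to complementation. -/
lemma closure_xorMatrix {a : ℕ} (ha : ∀ p : Fin 16, (p = 1 ∨ p = 2 ∨ p = 4 ∨ p = 8) →
      ∀ q x : Fin 16, secondDifference a p q x = secondDifference a p q 0) :
    closure (xorMatrix a) = 256 * 256 := by
  have hflip : flip (xorMatrix a) = xorMatrix a := by
    funext y x
    simp [flip, xorMatrix, Nat.xor_comm]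
  have h : closedPairs (xorMatrix a) = 256 := by
    -- The arguments y + x, y' + x, z + x and y + y' + z + x form a parallelogram, so the sum of the
    -- four rows at x is a second difference based at y + x.
    refine closedPairs_eq_card fun y y' z => ⟨y ^^^ y' ^^^ z, fun x x' => ?_⟩
    have key : ∀ x : Fin 16, (xorMatrix a y x ^^ xorMatrix a y' x ^^ xorMatrix a z x ^^
        xorMatrix a (y ^^^ y' ^^^ z) x) =
          secondDifference a (y ^^^ y' : Fin 16) (y ^^^ z : Fin 16) 0 := by
      intro x
      rw [← secondDifference_eq_of_basis ha (y ^^^ y') (y ^^^ z) (y ^^^ x)]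
      have h1 : y.val ^^^ x.val ^^^ (y.val ^^^ y'.val) = y'.val ^^^ x.val := by
        refine Nat.eq_of_testBit_eq fun i => ?_
        simp only [Nat.testBit_xor]
        grind
      have h2 : y.val ^^^ x.val ^^^ (y.val ^^^ z.val) = z.val ^^^ x.val := by
        refine Nat.eq_of_testBit_eq fun i => ?_
        simp only [Nat.testBit_xor]
        grind
      have h3 : y'.val ^^^ x.val ^^^ (y.val ^^^ z.val) = y.val ^^^ y'.val ^^^ z.val ^^^ x.val := by
        refine Nat.eq_of_testBit_eq fun i => ?_
        simp only [Nat.testBit_xor]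
        grind
      simp only [xorMatrix, secondDifference, val_xor, h1, h2, h3]
    rw [key, key]
  rw [closure, hflip, h]

/-! ### Counting closed pairs of the base designs -/

lemma testBit_eq_testBit_iff {a : ℕ} (ha : a < 2 ^ 16) :
    (∀ x x' : Fin 16, a.testBit x = a.testBit x') ↔ a = 0 ∨ a = 2 ^ 16 - 1 := by
  constructor
  · intro h
    cases h0 : a.testBit 0
    · left
      refine Nat.eq_of_testBit_eq fun i => ?_
      rcases lt_or_ge i 16 with hi | hi
      · simpa [h0] using h ⟨i, hi⟩ 0
      · rw [Nat.testBit_lt_two_pow (ha.trans_le (Nat.pow_le_pow_right two_pos hi)),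
          Nat.zero_testBit]
    · right
      refine Nat.eq_of_testBit_eq fun i => ?_
      rw [Nat.testBit_two_pow_sub_one]
      rcases lt_or_ge i 16 with hi | hi
      · simpa [h0, hi] using h ⟨i, hi⟩ 0
      · rw [Nat.testBit_lt_two_pow (ha.trans_le (Nat.pow_le_pow_right two_pos hi))]
        simpa using hi
  · rintro (rfl | rfl) x x'
    · simp
    · rw [Nat.testBit_two_pow_sub_one, Nat.testBit_two_pow_sub_one]
      simp

/-- Constancy of a sum of rows becomes a comparison of one xor of masks with 0 or 2 ^ 16 - 1, which
makes the count computable. -/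
lemma closedPairs_maskMatrix {L : List ℕ} (hL : ∀ y : Fin 16, L.getD y 0 < 2 ^ 16) :
    closedPairs (maskMatrix L) = (Finset.univ.filter fun p : Fin 16 × Fin 16 =>
      ∀ c : Fin 16, ∃ d : Fin 16,
        (L.getD p.1 0 ^^^ L.getD p.2 0 ^^^ L.getD c 0 ^^^ L.getD d 0) = 0 ∨
        (L.getD p.1 0 ^^^ L.getD p.2 0 ^^^ L.getD c 0 ^^^ L.getD d 0) = 2 ^ 16 - 1).card := by
  rw [closedPairs, Nat.card_eq_fintype_card, Fintype.card_subtype]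
  congr 1
  ext p
  simp only [Finset.mem_filter, Finset.mem_univ, true_and]
  refine forall_congr' fun c => exists_congr fun d => ?_
  rw [← testBit_eq_testBit_iff (Nat.xor_lt_two_pow (Nat.xor_lt_two_pow (Nat.xor_lt_two_pow
    (hL _) (hL _)) (hL _)) (hL _))]
  simp [maskMatrix]

lemma blockMatrix_blocksD2 (y x : ElemAb 2) :
    blockMatrix blocksD2 y x = maskMatrix masksD2 (lexEquiv y) (lexEquiv x) := by
  rw [Bool.eq_iff_iff, blockMatrix_eq_true]
  exact mem_blocksD2 x y

lemma blockMatrix_blocksD3 (y x : ElemAb 2) :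
    blockMatrix blocksD3 y x = maskMatrix masksD3 (lexEquiv y) (lexEquiv x) := by
  rw [Bool.eq_iff_iff, blockMatrix_eq_true]
  exact mem_blocksD3 x y

lemma isBentFamily_blocksD2 : IsBentFamily (blockMatrix blocksD2) 4 :=
  isBentFamily_of_masks blockMatrix_blocksD2
    ⟨by decide +kernel, by decide +kernel, by decide +kernel⟩
    ⟨by decide +kernel, by decide +kernel, by decide +kernel⟩ (by decide +kernel)

lemma isBentFamily_blocksD3 : IsBentFamily (blockMatrix blocksD3) 4 :=
  isBentFamily_of_masks blockMatrix_blocksD3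
    ⟨by decide +kernel, by decide +kernel, by decide +kernel⟩
    ⟨by decide +kernel, by decide +kernel, by decide +kernel⟩ (by decide +kernel)

/-- Block 0 was switched and block 2 was not, so the translate of block 0 by g₂ is not block 2; the
kernel checks that it is no other block either. -/
lemma not_translationClosed_blocksD2 : ¬ TranslationClosed (blockMatrix blocksD2) :=
  not_translationClosed_of_masks blockMatrix_blocksD2 ⟨0, 2, by decide +kernel⟩

lemma not_translationClosed_blocksD3 : ¬ TranslationClosed (blockMatrix blocksD3) :=
  not_translationClosed_of_masks blockMatrix_blocksD3 ⟨0, 2, by decide +kernel⟩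

lemma closure_translateMatrix_blocksD2 (y : ElemAb 2) :
    closure (translateMatrix (blockMatrix blocksD2) y) = 256 * 256 := by
  rw [(isotopic_translateMatrix_of_masks blockMatrix_blocksD2 y).closure_eq]
  apply closure_xorMatrix
  generalize lexEquiv y = z
  revert z
  decide +kernel

lemma closure_translateMatrix_blocksD3 (y : ElemAb 2) :
    closure (translateMatrix (blockMatrix blocksD3) y) = 256 * 256 := by
  rw [(isotopic_translateMatrix_of_masks blockMatrix_blocksD3 y).closure_eq]
  apply closure_xorMatrix
  generalize lexEquiv y = z
  revert z
  decide +kernel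

/-- The columns of `masksD2`. -/
def masksD2Flip : List ℕ :=
  [4382, 8749, 29768, 47236, 4577, 8914, 17588, 34936, 7697, 11554, 19268, 34696,
    57617, 53794, 33863, 18571]

/-- The columns of `masksD3`. -/
def masksD3Flip : List ℕ :=
  [4382, 8749, 29768, 47236, 4577, 8914, 17543, 34891, 7697, 11554, 19268, 34696,
    57617, 53794, 33908, 18616]

/-- After the first switch only 64 of the 256 ordered pairs of rows are closed, and as many pairs of
columns; the second switch halves both counts. -/
lemma closure_blocksD2 : closure (blockMatrix blocksD2) = 64 * 64 := by
  have h : Isotopic (blockMatrix blocksD2) (maskMatrix masksD2) :=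
    ⟨lexEquiv, lexEquiv, blockMatrix_blocksD2⟩
  have hflip : flip (maskMatrix masksD2) = maskMatrix masksD2Flip := by
    decide +kernel
  rw [h.closure_eq, closure, hflip, closedPairs_maskMatrix (by decide +kernel),
    closedPairs_maskMatrix (by decide +kernel)]
  exact congrArg₂ (· * ·) (by decide +kernel) (by decide +kernel)

lemma closure_blocksD3 : closure (blockMatrix blocksD3) = 32 * 32 := by
  have h : Isotopic (blockMatrix blocksD3) (maskMatrix masksD3) :=
    ⟨lexEquiv, lexEquiv, blockMatrix_blocksD3⟩
  have hflip : flip (maskMatrix masksD3) = maskMatrix masksD3Flip := by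
    decide +kernel
  rw [h.closure_eq, closure, hflip, closedPairs_maskMatrix (by decide +kernel),
    closedPairs_maskMatrix (by decide +kernel)]
  exact congrArg₂ (· * ·) (by decide +kernel) (by decide +kernel)

end Base

/-! ### Assembly for all m and n -/

lemma isNonDevelopedDifferenceSetDesign_liftedBlocks {B : ElemAb 2 → Finset (ElemAb 2)}
    (hB : IsBentFamily (blockMatrix B) 4) (hB' : ¬ TranslationClosed (blockMatrix B))
    {m v k lam : ℕ} (hv : v = 4 ^ (m + 2)) (hk : (v : ℤ) = 2 * k + 2 ^ (m + 2))
    (hlam : (v : ℤ) = 4 * lam + 2 * 2 ^ (m + 2)) :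
    IsNonDevelopedDifferenceSetDesign (liftedBlocks B (m + 2)) v k lam := by
  have h := isBentFamily_liftedBlocks hB m
  have hcard : Fintype.card (ElemAb (m + 2)) = v := by
    rw [hv]
    simp
  exact ⟨h.isSymmetricDesign (Equiv.refl _) hcard hk hlam, h.isDifferenceSet hcard hk hlam,
    fun D _ _ _ hD => not_translationClosed_liftedBlocks hB' m
      (translationClosed_of_range_eq_development hD)⟩

end DesignCube

open DesignCube

theorem theorem4p2 (m n v k lam : ℕ) (hm : 2 ≤ m) (hn : 3 ≤ n) (hv : v = 4 ^ m)
    (hk : k = 2 ^ (m - 1) * (2 ^ m - 1)) (hlam : lam = 2 ^ (m - 1) * (2 ^ (m - 1) - 1)) :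
    DesignCube.IsNonDevelopedDifferenceSetDesign
        (DesignCube.liftedBlocks DesignCube.blocksD2 m) v k lam ∧
      DesignCube.IsNonDevelopedDifferenceSetDesign
        (DesignCube.liftedBlocks DesignCube.blocksD3 m) v k lam ∧
      ∃ C₁ C₂ : DesignCube.Cube n v,
        C₁ ∈ DesignCube.designCubes n v k lam ∧
        C₂ ∈ DesignCube.designCubes n v k lam ∧
        DesignCube.IsGroupCube k lam C₁ ∧
        DesignCube.IsGroupCube k lam C₂ ∧
        DesignCube.IsNonDifferenceCube C₁ ∧
        DesignCube.IsNonDifferenceCube C₂ ∧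
        ¬ DesignCube.Equivalent C₁ C₂ ∧
        ∃ g : Fin v ≃ DesignCube.ElemAb m,
          C₁ = DesignCube.groupCube n g
            (fun i => DesignCube.liftedBlocks DesignCube.blocksD2 m (g i)) ∧
          C₂ = DesignCube.groupCube n g
            (fun i => DesignCube.liftedBlocks DesignCube.blocksD3 m (g i)) := by
  obtain ⟨m, rfl⟩ := Nat.exists_eq_add_of_le' hm
  obtain ⟨n, rfl⟩ := Nat.exists_eq_add_of_le' hn
  have hone : 1 ≤ 2 ^ (m + 1) := Nat.one_le_two_pow
  have hone' : 1 ≤ 2 ^ (m + 2) := Nat.one_le_two_pow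
  have hpow : (4 : ℤ) ^ m = 2 ^ m * 2 ^ m := by
    rw [← mul_pow]
    norm_num
  -- The common sum of signs is s = v - 2k = 2 ^ m in the original m, which is m + 2 after the
  -- shift.
  have hk' : (v : ℤ) = 2 * k + 2 ^ (m + 2) := by
    rw [hk, hv, show m + 2 - 1 = m + 1 from rfl]
    push_cast [Nat.cast_sub hone']
    simp only [pow_succ, hpow]
    ring
  have hlam' : (v : ℤ) = 4 * lam + 2 * 2 ^ (m + 2) := by
    rw [hlam, hv, show m + 2 - 1 = m + 1 from rfl]
    push_cast [Nat.cast_sub hone]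
    simp only [pow_succ, hpow]
    ring
  have hcard : Fintype.card (ElemAb (m + 2)) = v := by
    rw [hv]
    simp
  have h2 := isBentFamily_liftedBlocks isBentFamily_blocksD2 m
  have h3 := isBentFamily_liftedBlocks isBentFamily_blocksD3 m
  have c2 := closure_liftedBlocks blocksD2 m
  have c3 := closure_liftedBlocks blocksD3 m
  have t2 := closure_translateMatrix_liftedBlocks closure_translateMatrix_blocksD2 m
  have t3 := closure_translateMatrix_liftedBlocks closure_translateMatrix_blocksD3 m
  rw [closure_blocksD2] at c2
  rw [closure_blocksD3] at c3
  have hpos : 0 < 256 ^ m := by positivity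
  -- Any ordering of the group would do.
  let g : Fin v ≃ ElemAb (m + 2) := (Fintype.equivFinOfCardEq hcard).symm
  refine ⟨isNonDevelopedDifferenceSetDesign_liftedBlocks isBentFamily_blocksD2
      not_translationClosed_blocksD2 hv hk' hlam',
    isNonDevelopedDifferenceSetDesign_liftedBlocks isBentFamily_blocksD3
      not_translationClosed_blocksD3 hv hk' hlam', _, _,
    h2.groupCube_mem_designCubes g hk' hlam', h3.groupCube_mem_designCubes g hk' hlam',
    ⟨_, _, g, _, h2.isSymmetricDesign g hcard hk' hlam',
      fun j => h2.isDifferenceSet hcard hk' hlam' _, rfl⟩,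
    ⟨_, _, g, _, h3.isSymmetricDesign g hcard hk' hlam',
      fun j => h3.isDifferenceSet hcard hk' hlam' _, rfl⟩,
    isNonDifferenceCube_groupCube g _ fun z => ?_, isNonDifferenceCube_groupCube g _ fun z => ?_,
    not_equivalent_groupCube g _ _ ?_ fun z => ?_, g, rfl, rfl⟩
  -- Up to the common factor 256 ^ m, the translates have closure 256², the first design 64² and the
  -- second 32²; these are pairwise distinct.
  · rw [t2, c2]
    omega
  · rw [t3, c3]
    omega
  · rw [c2, c3]
    omega
  · rw [t3, c2]
    omega
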